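/- **Theorem.** Let $n\ge 0$, let $I\subseteq\mathbb{R}$ be a Lebesgue measurable set, and let $f_0,\dots,f_n:\mathbb{R}\to\mathbb{R}$ be functions that are differentiable at every point of $I$; put $v(t)=(f_0(t),\dots,f_n(t))^T$. Let $a=(a_0,\dots,a_n)^T$ be a random vector with the multivariate normal distribution with mean zero and covariance matrix $C$, where $C$ is a positive semidefinite real matrix (possibly singular), and let $C^{1/2}$ be its positive semidefinite square root. Put $w(t)=C^{1/2}v(t)$, assume that $w(t)\neq 0$ for every $t\in I$, and let $\mathbf{w}(t)=w(t)/\|w(t)\|$, where $\|\cdot\|$ is the Euclidean norm. Then $\mathbf{w}$ is differentiable at every $t\in I$, and for every $t\in I$ the kernel $v(x)^TCv(y)$ is positive for $(x,y)$ near $(t,t)$, the mixed partial derivative $\frac{\partial^2}{\partial x\,\partial y}\log\big(v(x)^TCv(y)\big)$ exists at $x=y=t$, and its value there is nonnegative. Let $N_I$ be the number (possibly infinite) of distinct $t\in I$ with $$a_0f_0(t)+a_1f_1(t)+\cdots+a_nf_n(t)=0.$$ Then $N_I$ is measurable with respect to the completed probability space, and its expectation is $$E(N_I)=\frac1\pi\int_I\|\mathbf{w}'(t)\|\,dt=\frac1\pi\int_I\left(\frac{\partial^2}{\partial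 x\,\partial y}\log\big(v(x)^TCv(y)\big)\Big|_{y=x=t}\right)^{1/2}dt,$$ where the three quantities are elements of $[0,\infty]$ (so they are finite or infinite together). -/

import Mathlib

open MeasureTheory ProbabilityTheory Filter
open scoped ENNReal Topology MatrixOrder

/-- The curve `v(t) = (f₀(t), …, fₙ(t))` in Euclidean space `ℝⁿ⁺¹`. -/
def basisCurve {n : ℕ} (f : Fin (n + 1) → ℝ → ℝ) (t : ℝ) : EuclideanSpace ℝ (Fin (n + 1)) :=
  WithLp.toLp 2 (fun i => f i t)

/-- The curve `w(t) = C^{1/2} v(t)`, with `C^{1/2}` the positive semidefinite square root of the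
positive semidefinite matrix `C`. -/
noncomputable def rootCurve {n : ℕ} (C : Matrix (Fin (n + 1)) (Fin (n + 1)) ℝ)
    (f : Fin (n + 1) → ℝ → ℝ) (t : ℝ) : EuclideanSpace ℝ (Fin (n + 1)) :=
  Matrix.toEuclideanCLM (𝕜 := ℝ) (CFC.sqrt C) (basisCurve f t)

/-- The normalized curve `w(t) / ‖w(t)‖` on the unit sphere. -/
noncomputable def unitCurve {n : ℕ} (C : Matrix (Fin (n + 1)) (Fin (n + 1)) ℝ)
    (f : Fin (n + 1) → ℝ → ℝ) (t : ℝ) : EuclideanSpace ℝ (Fin (n + 1)) :=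
  ‖rootCurve C f t‖⁻¹ • rootCurve C f t

/-- The function `(x, y) ↦ v(x)ᵀ C v(y)`. -/
noncomputable def covKernel {n : ℕ} (C : Matrix (Fin (n + 1)) (Fin (n + 1)) ℝ)
    (f : Fin (n + 1) → ℝ → ℝ) (x y : ℝ) : ℝ :=
  (fun i => f i x) ⬝ᵥ (C.mulVec (fun i => f i y))

/-- The partial derivative in the second variable, `∂g/∂y (x, y)`. -/
noncomputable def partialSnd (g : ℝ → ℝ → ℝ) (x y : ℝ) : ℝ :=
  deriv (fun y' => g x y') y

/-- The mixed partial derivative `∂²g/∂x∂y (x, y)`. -/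
noncomputable def mixedPartial (g : ℝ → ℝ → ℝ) (x y : ℝ) : ℝ :=
  deriv (fun x' => partialSnd g x' y) x

/-- The mixed partial derivative `∂²g/∂x∂y` exists at `(x, y)`: `∂g/∂y` exists at `(x', y)` for all
`x'` near `x`, and is differentiable in `x'` at `x`. -/
def HasMixedPartialAt (g : ℝ → ℝ → ℝ) (x y : ℝ) : Prop :=
  (∀ᶠ x' in 𝓝 x, DifferentiableAt ℝ (fun y' => g x' y') y) ∧
    DifferentiableAt ℝ (fun x' => partialSnd g x' y) x

/-- The number (possibly `∞`) of distinct `t ∈ I` with `a₀ f₀(t) + ⋯ + aₙ fₙ(t) = 0`. -/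
noncomputable def zeroCount {n : ℕ} (f : Fin (n + 1) → ℝ → ℝ) (I : Set ℝ)
    (a : EuclideanSpace ℝ (Fin (n + 1))) : ℝ≥0∞ :=
  ((({t : ℝ | t ∈ I ∧ ∑ i, a i * f i t = 0}).encard : ℕ∞) : ℝ≥0∞)

/-!
Writing `a = C^{1/2} g` with `g` standard Gaussian, the zeros of `∑ aᵢ fᵢ` are the points `t ∈ I`
with `⟪w t, g⟫ = 0`. On the part of `I` where a given coordinate `wᵢ` does not vanish, dividing by
it turns this equation into `gᵢ = -⟪q t, b⟫`, where `b` consists of the other coordinates of `g`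
and `q = (wⱼ / wᵢ)_{j ≠ i}`. For fixed `b` the number of zeros is therefore the number of preimages
of `gᵢ` under a real function of one variable that is differentiable on `I`, and the area formula
with multiplicity (`areaFormulaOn`) expresses its mean over `gᵢ` as
`∫ |⟪q' t, b⟫| φ(⟪q t, b⟫) dt`, with `φ` the standard normal density. Averaging over `b` is an
explicit Gaussian integral (`lintegral_abs_inner_mul_gaussianPDF`), whose value is `1 / π` times
the square root of a Gram determinant of `(1, q)` and its derivative over `‖(1, q)‖²`. This quotient
does not change when the curve is multiplied by a scalar function, so it equals the same expression
in `w`, which is `‖(w / ‖w‖)'‖` (`norm_deriv_normalize`) and whose square is the mixed logarithmic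
derivative of the kernel `⟪w x, w y⟫` (`hasMixedPartialAt_log_inner`). The pieces add up to `I`
(`kacRiceOn`).

Two points need care because the `fᵢ` are arbitrary outside `I` and `C` may be singular.
Joint measurability of the number of zeros in `(b, gᵢ)` comes from the area formula in dimension
`n + 1` for `(b, t) ↦ (b, -⟪q t, b⟫)`: this map sends null sets to null sets, which slicing alone
would not give. And measurability of the number of zeros as a function of `g` is carried over
to a function of `a` by `aemeasurable_map_stdGaussian`.
-/

open scoped RealInnerProductSpace

/-! ### The area formula with multiplicity -/

theorem Set.encard_iUnion_eq_tsum {α ι : Type*} [Countable ι] {s : ι → Set α}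
    (hs : Pairwise (Function.onFun Disjoint s)) :
    ((⋃ n, s n).encard : ℝ≥0∞) = ∑' n, ((s n).encard : ℝ≥0∞) := by
  let _ : MeasurableSpace α := ⊤
  have h := measure_iUnion (μ := Measure.count) hs fun n =>
    MeasurableSpace.measurableSet_top (s := s n)
  simpa [Measure.count_apply] using h

/-- The number (possibly `∞`) of preimages of `y` under `f` that lie in `s`. -/
noncomputable def fiberCount {α β : Type*} (f : α → β) (s : Set α) (y : β) : ℝ≥0∞ :=
  ((s ∩ f ⁻¹' {y}).encard : ℝ≥0∞)

theorem fiberCount_iUnion {α β : Type*} (f : α → β) {s : ℕ → Set α}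
    (hs : Pairwise (Function.onFun Disjoint s)) (y : β) :
    fiberCount f (⋃ n, s n) y = ∑' n, fiberCount f (s n) y := by
  unfold fiberCount
  rw [Set.iUnion_inter]
  exact Set.encard_iUnion_eq_tsum fun i j hij =>
    (hs hij).mono Set.inter_subset_left Set.inter_subset_left

theorem fiberCount_eq_zero {α β : Type*} {f : α → β} {s : Set α} {y : β} (hy : y ∉ f '' s) :
    fiberCount f s y = 0 := by
  have : s ∩ f ⁻¹' {y} = ∅ := by
    ext x
    simp only [Set.mem_inter_iff, Set.mem_preimage, Set.mem_singleton_iff,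
      Set.mem_empty_iff_false, iff_false, not_and]
    exact fun hx h => hy ⟨x, hx, h⟩
  simp [fiberCount, this]

theorem fiberCount_of_injOn {α β : Type*} {f : α → β} {s : Set α} (hf : Set.InjOn f s) (y : β) :
    fiberCount f s y = (f '' s).indicator 1 y := by
  by_cases hy : y ∈ f '' s
  · obtain ⟨x, hx, rfl⟩ := hy
    have : s ∩ f ⁻¹' {f x} = {x} := by
      ext z
      simp only [Set.mem_inter_iff, Set.mem_preimage, Set.mem_singleton_iff]
      exact ⟨fun h => hf h.1 hx h.2, by rintro rfl; exact ⟨hx, rfl⟩⟩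
    simp [fiberCount, this, Set.mem_image_of_mem f hx]
  · simp [fiberCount_eq_zero hy, hy]

section AreaFormula

variable {E : Type*} [NormedAddCommGroup E] [NormedSpace ℝ E] [MeasurableSpace E]
  {μ : Measure E} {f : E → E} {f' : E → E →L[ℝ] E} {s : Set E}

/-- The conclusion of the area formula with multiplicity for `f` on `s`, where `f'` stands for the
derivative of `f`. -/
def AreaFormulaOn (μ : Measure E) (f : E → E) (f' : E → E →L[ℝ] E) (s : Set E) : Prop :=
  AEMeasurable (fiberCount f s) μ ∧ ∀ g : E → ℝ≥0∞, AEMeasurable g μ →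
    ∫⁻ y, fiberCount f s y * g y ∂μ = ∫⁻ x in s, ENNReal.ofReal |(f' x).det| * g (f x) ∂μ

theorem AreaFormulaOn.iUnion {s : ℕ → Set E} (hs : Pairwise (Function.onFun Disjoint s))
    (hm : ∀ n, NullMeasurableSet (s n) μ) (h : ∀ n, AreaFormulaOn μ f f' (s n)) :
    AreaFormulaOn μ f f' (⋃ n, s n) := by
  refine ⟨?_, fun g hg => ?_⟩
  · have : fiberCount f (⋃ n, s n) = fun y => ∑' n, fiberCount f (s n) y :=
      funext (fiberCount_iUnion f hs)
    rw [this]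
    exact AEMeasurable.tsum fun n => (h n).1
  · rw [lintegral_iUnion₀ hm (fun i j hij => (hs hij).aedisjoint)]
    simp_rw [fiberCount_iUnion f hs, ← ENNReal.tsum_mul_right, ← (h _).2 g hg]
    exact lintegral_tsum fun n => (h n).1.mul hg

theorem AreaFormulaOn.union {s t : Set E} (hst : Disjoint s t)
    (ht : NullMeasurableSet t μ)
    (h : AreaFormulaOn μ f f' s) (h' : AreaFormulaOn μ f f' t) :
    AreaFormulaOn μ f f' (s ∪ t) := by
  have hfc (y : E) : fiberCount f (s ∪ t) y = fiberCount f s y + fiberCount f t y := by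
    unfold fiberCount
    rw [Set.union_inter_distrib_right, Set.encard_union_eq
      (hst.mono Set.inter_subset_left Set.inter_subset_left)]
    simp
  refine ⟨?_, fun g hg => ?_⟩
  · exact (h.1.add h'.1).congr (ae_of_all _ fun y => (hfc y).symm)
  · simp_rw [hfc, add_mul]
    have hadd := lintegral_add_left' (f := fun y => fiberCount f s y * g y) (h.1.mul hg)
      fun y => fiberCount f t y * g y
    rw [hadd, h.2 g hg, h'.2 g hg, Measure.restrict_union₀ hst.aedisjoint ht, lintegral_add_measure]

/-- Points outside the image do not contribute, so both sides vanish when the image is null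
and the Jacobian vanishes almost everywhere. -/
theorem areaFormulaOn_of_image_null (h0 : μ (f '' s) = 0)
    (hdet : ∀ᵐ x ∂μ.restrict s, (f' x).det = 0) : AreaFormulaOn μ f f' s := by
  have h : fiberCount f s =ᵐ[μ] 0 := by
    filter_upwards [measure_eq_zero_iff_ae_notMem.1 h0] with y hy using fiberCount_eq_zero hy
  refine ⟨aemeasurable_const.congr h.symm, fun g _ => ?_⟩
  rw [lintegral_congr_ae (g := fun _ => 0), lintegral_congr_ae (μ := μ.restrict s) (g := fun _ => 0)]
  · simp
  · filter_upwards [hdet] with x hx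
    simp [hx]
  · filter_upwards [h] with y hy
    simp [hy]

variable [FiniteDimensional ℝ E] [BorelSpace E] [μ.IsAddHaarMeasure]

theorem areaFormulaOn_of_null (hf' : ∀ x ∈ s, HasFDerivWithinAt f (f' x) s x) (h0 : μ s = 0) :
    AreaFormulaOn μ f f' s :=
  areaFormulaOn_of_image_null
    (addHaar_image_eq_zero_of_differentiableOn_of_addHaar_eq_zero μ
      (fun x hx => (hf' x hx).differentiableWithinAt) h0)
    (by simp [Measure.restrict_eq_zero.2 h0])

theorem areaFormulaOn_of_injOn (hs : MeasurableSet s)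
    (hf' : ∀ x ∈ s, HasFDerivWithinAt f (f' x) s x) (hf : Set.InjOn f s) :
    AreaFormulaOn μ f f' s := by
  have hm := measurable_image_of_fderivWithin hs hf' hf
  have h1 : fiberCount f s = (f '' s).indicator 1 := funext (fiberCount_of_injOn hf)
  refine ⟨?_, fun g _ => ?_⟩
  · rw [h1]
    exact (measurable_one.indicator hm).aemeasurable
  · rw [← lintegral_image_eq_lintegral_abs_det_fderiv_mul μ hs hf' hf, ← lintegral_indicator hm, h1]
    refine lintegral_congr fun y => ?_
    by_cases hy : y ∈ f '' s <;> simp [hy]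

theorem areaFormulaOn_of_det_ne_zero (hs : MeasurableSet s)
    (hf' : ∀ x ∈ s, HasFDerivWithinAt f (f' x) s x) (hdet : ∀ x ∈ s, (f' x).det ≠ 0) :
    AreaFormulaOn μ f f' s := by
  classical
  -- An invertible `A` admits a radius `c A` such that `c A`-perturbations of `A` are injective.
  have hc (A : E →L[ℝ] E) : ∃ c : NNReal, c ≠ 0 ∧
      (A.det ≠ 0 → ∀ t, ApproximatesLinearOn f A t c → Set.InjOn f t) := by
    by_cases hA : A.det = 0
    · exact ⟨1, one_ne_zero, fun h => absurd hA h⟩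
    · let B := A.toContinuousLinearEquivOfDetNeZero hA
      have hB : (B : E →L[ℝ] E) = A := A.coe_toContinuousLinearEquivOfDetNeZero hA
      rcases subsingleton_or_nontrivial E with hE | hE
      · exact ⟨1, one_ne_zero, fun _ t _ x _ y _ _ => Subsingleton.elim x y⟩
      · have hpos := B.nnnorm_symm_pos
        refine ⟨‖(B.symm : E →L[ℝ] E)‖₊⁻¹ / 2, by positivity, fun _ t ht => ?_⟩
        rw [← hB] at ht
        exact ht.injOn (Or.inr (half_lt_self (by positivity)))
  choose c hc0 hcinj using hc
  rcases s.eq_empty_or_nonempty with rfl | hne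
  · exact areaFormulaOn_of_null (by simp) (by simp)
  obtain ⟨t, A, t_disj, t_meas, t_cover, t_approx, hA⟩ :=
    exists_partition_approximatesLinearOn_of_hasFDerivWithinAt f s f' hf' c hc0
  have hst : s = ⋃ n, s ∩ t n := by
    rw [← Set.inter_iUnion]
    exact (Set.inter_eq_left.2 t_cover).symm
  rw [hst]
  refine AreaFormulaOn.iUnion
    (fun i j hij => (t_disj hij).mono Set.inter_subset_right Set.inter_subset_right)
    (fun n => (hs.inter (t_meas n)).nullMeasurableSet) fun n => ?_
  refine areaFormulaOn_of_injOn (hs.inter (t_meas n))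
    (fun x hx => (hf' x hx.1).mono Set.inter_subset_left) ?_
  obtain ⟨y, hy, hAy⟩ := hA hne n
  exact hcinj (A n) (hAy ▸ hdet y hy) _ (t_approx n)

/-- **Area formula with multiplicity**, in equal dimensions, for a map that is merely
differentiable at the points of a null-measurable set. The critical points have null image by
Sard's lemma, and the rest is a countable union of pieces on which the map is injective. -/
theorem areaFormulaOn (hs : NullMeasurableSet s μ)
    (hf' : ∀ x ∈ s, HasFDerivWithinAt f (f' x) s x) : AreaFormulaOn μ f f' s := by
  -- A null-measurable set contains a measurable set of full measure, and null sets are harmless.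
  have key : ∀ t : Set E, MeasurableSet t → t ⊆ s → AreaFormulaOn μ f f' t := by
    intro t ht hts
    have hft : ∀ x ∈ t, HasFDerivWithinAt f (f' x) t x := fun x hx => (hf' x (hts hx)).mono hts
    -- `f'` is only a.e. measurable, so the regular set is replaced by a measurable subset `D`.
    have hD : NullMeasurableSet {x ∈ t | (f' x).det ≠ 0} μ := by
      have h1 : NullMeasurableSet {x | (f' x).det ≠ 0} (μ.restrict t) :=
        (ContinuousLinearMap.continuous_det.measurable.comp_aemeasurable
          (aemeasurable_fderivWithin μ ht hft)).nullMeasurableSet_preimage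
          (measurableSet_singleton (0 : ℝ)).compl
      rw [nullMeasurableSet_restrict ht.nullMeasurableSet] at h1
      rwa [Set.inter_comm] at h1
    obtain ⟨D, hDsub, hDm, hDae⟩ := hD.exists_measurable_subset_ae_eq
    have hDt : D ⊆ t := fun x hx => (hDsub hx).1
    have hrest : AreaFormulaOn μ f f' (t \ D) := by
      have hnull : μ ({x ∈ t | (f' x).det ≠ 0} \ D) = 0 := (ae_eq_set.1 hDae).2
      refine areaFormulaOn_of_image_null ?_ ?_
      · have hsub : f '' (t \ D) ⊆
            f '' ({x ∈ t | (f' x).det ≠ 0} \ D) ∪ f '' {x ∈ t | (f' x).det = 0} := by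
          rw [← Set.image_union]
          refine Set.image_mono fun x hx => ?_
          by_cases h : (f' x).det = 0
          · exact Or.inr ⟨hx.1, h⟩
          · exact Or.inl ⟨⟨hx.1, h⟩, hx.2⟩
        refine measure_mono_null hsub (measure_union_null ?_ ?_)
        · exact addHaar_image_eq_zero_of_differentiableOn_of_addHaar_eq_zero μ
            (fun x hx => ((hft x hx.1.1).mono fun z hz => hz.1.1).differentiableWithinAt) hnull
        · exact addHaar_image_eq_zero_of_det_fderivWithin_eq_zero μ
            (fun x hx => (hft x hx.1).mono fun z hz => hz.1) fun x hx => hx.2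
      · rw [ae_restrict_iff' (ht.diff hDm)]
        filter_upwards [measure_eq_zero_iff_ae_notMem.1 hnull] with x hx hxt
        by_contra h
        exact hx ⟨⟨hxt.1, h⟩, hxt.2⟩
    have := AreaFormulaOn.union (Set.disjoint_sdiff_right)
      (ht.diff hDm).nullMeasurableSet
      (areaFormulaOn_of_det_ne_zero hDm (fun x hx => (hft x (hDt hx)).mono hDt)
        fun x hx => (hDsub hx).2) hrest
    rwa [Set.union_sdiff_cancel hDt] at this
  obtain ⟨t, hts, htm, hae⟩ := hs.exists_measurable_subset_ae_eq
  have := AreaFormulaOn.union (Set.disjoint_sdiff_right)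
    (hs.diff htm.nullMeasurableSet) (key t htm hts)
    (areaFormulaOn_of_null (fun x hx => (hf' x hx.1).mono Set.sdiff_subset) (ae_eq_set.1 hae).2)
  rwa [Set.union_sdiff_cancel hts] at this

end AreaFormula

/-! ### Gaussian integrals in one and two variables -/

/-- The first absolute moment of a centred Gaussian; for `v = 0` both sides vanish. -/
theorem lintegral_abs_gaussianReal (v : NNReal) :
    ∫⁻ x, ENNReal.ofReal |x| ∂gaussianReal 0 v = ENNReal.ofReal (√(2 * v / Real.pi)) := by
  by_cases hv : v = 0
  · simp [hv]
  have hv0 : (0 : ℝ) < v := by positivity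
  have hint : Integrable (fun x : ℝ => |x|) (gaussianReal 0 v) :=
    (IsGaussian.integrable_id (μ := gaussianReal 0 v)).abs
  rw [← ofReal_integral_eq_lintegral_ofReal hint (ae_of_all _ fun x => abs_nonneg x)]
  congr 1
  rw [integral_gaussianReal_eq_integral_smul hv]
  have h1 (x : ℝ) : gaussianPDFReal 0 v x • |x| =
      (fun y => (√(2 * Real.pi * v))⁻¹ * (y ^ (1 : ℝ) * Real.exp (-(1 / (2 * v)) * y ^ (2 : ℝ))))
        |x| := by
    simp only [gaussianPDFReal, sub_zero, smul_eq_mul, Real.rpow_one, Real.rpow_two, sq_abs]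
    ring_nf
  simp_rw [h1]
  rw [integral_comp_abs (f := fun y => (√(2 * Real.pi * v))⁻¹ *
    (y ^ (1 : ℝ) * Real.exp (-(1 / (2 * v)) * y ^ (2 : ℝ)))), integral_const_mul,
    integral_rpow_mul_exp_neg_mul_rpow (by norm_num) (by norm_num) (by positivity)]
  have hpow : (1 / (2 * (v : ℝ))) ^ (-(1 + 1 : ℝ) / 2) = 2 * v := by
    rw [show (-(1 + 1 : ℝ) / 2) = -1 by norm_num, Real.rpow_neg_one]
    field_simp
  rw [hpow, show ((1 : ℝ) + 1) / 2 = 1 by norm_num, Real.Gamma_one, eq_comm,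
    Real.sqrt_eq_iff_mul_self_eq_of_pos (by positivity)]
  field_simp
  rw [Real.sq_sqrt (by positivity)]

/-- A centred Gaussian density tilted by the standard Gaussian density is again Gaussian. -/
theorem gaussianReal_withDensity_gaussianPDF (v : NNReal) :
    (gaussianReal 0 v).withDensity (gaussianPDF 0 1) =
      gaussianPDF 0 (1 + v) 0 • gaussianReal 0 (v / (1 + v)) := by
  by_cases hv : v = 0
  · subst hv
    ext s hs
    classical
    rw [withDensity_apply _ hs, gaussianReal_zero_var, restrict_dirac' hs]
    by_cases h0 : (0 : ℝ) ∈ s <;> simp [hs, h0]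
  have hv' : v / (1 + v) ≠ 0 := by positivity
  have hv0 : (0 : ℝ) < v := by positivity
  rw [gaussianReal_of_var_ne_zero _ hv, gaussianReal_of_var_ne_zero _ hv',
    ← withDensity_mul _ (by fun_prop) (by fun_prop), ← withDensity_smul _ (by fun_prop)]
  congr 1
  ext x
  simp only [Pi.mul_apply, Pi.smul_apply, smul_eq_mul, gaussianPDF]
  rw [← ENNReal.ofReal_mul (gaussianPDFReal_nonneg _ _ _),
    ← ENNReal.ofReal_mul (gaussianPDFReal_nonneg _ _ _)]
  congr 1
  simp only [gaussianPDFReal, sub_zero, NNReal.coe_one, NNReal.coe_add, NNReal.coe_div]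
  have h1 : √(2 * Real.pi * v) * √(2 * Real.pi * 1) =
      √(2 * Real.pi * (1 + v)) * √(2 * Real.pi * (v / (1 + v))) := by
    rw [← Real.sqrt_mul (by positivity), ← Real.sqrt_mul (by positivity)]
    congr 1
    field_simp
  have h2 : Real.exp (-x ^ 2 / (2 * v)) * Real.exp (-x ^ 2 / (2 * 1)) =
      Real.exp (-0 ^ 2 / (2 * (1 + v))) * Real.exp (-x ^ 2 / (2 * (v / (1 + v)))) := by
    rw [← Real.exp_add, ← Real.exp_add]
    congr 1
    field_simp
    ring
  calc _ = (√(2 * Real.pi * v) * √(2 * Real.pi * 1))⁻¹ *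
        (Real.exp (-x ^ 2 / (2 * v)) * Real.exp (-x ^ 2 / (2 * 1))) := by
          rw [mul_inv]; ring
    _ = _ := by rw [h1, h2, mul_inv]; ring

section StdGaussian

variable {F : Type*} [NormedAddCommGroup F] [InnerProductSpace ℝ F] [FiniteDimensional ℝ F]
  [MeasurableSpace F] [BorelSpace F]

theorem map_inner_stdGaussian (q : F) :
    (stdGaussian F).map (fun b => ⟪q, b⟫) = gaussianReal 0 (‖q‖₊ ^ 2) := by
  have h := IsGaussian.map_eq_gaussianReal (μ := stdGaussian F) (innerSL ℝ q)
  simp only [integral_strongDual_stdGaussian, variance_dual_stdGaussian, innerSL_apply_norm] at h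
  rw [Real.toNNReal_pow (norm_nonneg q), norm_toNNReal] at h
  exact h

theorem map_inner_inner_stdGaussian {q r : F} (hqr : ⟪q, r⟫ = 0) :
    (stdGaussian F).map (fun b => (⟪q, b⟫, ⟪r, b⟫)) =
      (gaussianReal 0 (‖q‖₊ ^ 2)).prod (gaussianReal 0 (‖r‖₊ ^ 2)) := by
  have hg : HasGaussianLaw (fun b => (⟪q, b⟫, ⟪r, b⟫)) (stdGaussian F) :=
    ⟨inferInstanceAs (IsGaussian ((stdGaussian F).map ((innerSL ℝ q).prod (innerSL ℝ r))))⟩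
  have hind : IndepFun (fun b => ⟪q, b⟫) (fun b => ⟪r, b⟫) (stdGaussian F) := by
    refine hg.indepFun_of_covariance_eq_zero ?_
    rw [← covarianceBilin_apply_eq_cov IsGaussian.memLp_two_id, covarianceBilin_stdGaussian]
    exact hqr
  rw [(indepFun_iff_map_prod_eq_prod_map_map (by fun_prop) (by fun_prop)).1 hind,
    map_inner_stdGaussian, map_inner_stdGaussian]

theorem map_mul_add_gaussianReal_prod (c : ℝ) (v w : NNReal) :
    ((gaussianReal 0 v).prod (gaussianReal 0 w)).map (fun p => c * p.1 + p.2) =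
      gaussianReal 0 (NNReal.mk (c ^ 2) (sq_nonneg c) * v + w) := by
  have h := gaussianReal_conv_gaussianReal (m₁ := c * 0) (m₂ := 0)
    (v₁ := .mk (c ^ 2) (sq_nonneg c) * v) (v₂ := w)
  rw [← gaussianReal_map_const_mul, Measure.conv] at h
  have h2 := Measure.map_prod_map (gaussianReal 0 v) (gaussianReal 0 w) (f := (c * ·)) (g := id)
    (by fun_prop) (by fun_prop)
  rw [Measure.map_id] at h2
  rw [h2, Measure.map_map (by fun_prop) (by fun_prop), mul_zero, add_zero] at h
  exact h

/-- The Gaussian integral behind the Kac-Rice density: the mean of `|⟪p, b⟫|` weighted by the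
standard normal density at `⟪q, b⟫`. -/
theorem lintegral_abs_inner_mul_gaussianPDF (p q : F) :
    ∫⁻ b, ENNReal.ofReal |⟪p, b⟫| * gaussianPDF 0 1 ⟪q, b⟫ ∂stdGaussian F =
      ENNReal.ofReal (1 / Real.pi) * ENNReal.ofReal
        (√(‖p‖ ^ 2 * (1 + ‖q‖ ^ 2) - ⟪q, p⟫ ^ 2) / (1 + ‖q‖ ^ 2)) := by
  -- Split `p` into its component along `q` and an orthogonal remainder `r`; for `q = 0` the
  -- coefficient is `0 / 0 = 0` and `r = p`.
  obtain ⟨c, r, hqr, hp⟩ : ∃ (c : ℝ) (r : F), ⟪q, r⟫ = 0 ∧ p = c • q + r := by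
    refine ⟨⟪q, p⟫ / ‖q‖ ^ 2, p - (⟪q, p⟫ / ‖q‖ ^ 2) • q, ?_, by simp⟩
    rcases eq_or_ne q 0 with rfl | hq
    · simp
    · have : ‖q‖ ≠ 0 := norm_ne_zero_iff.2 hq
      rw [inner_sub_right, inner_smul_right, real_inner_self_eq_norm_sq]
      field_simp
      simp
  set v : NNReal := ‖q‖₊ ^ 2 with hv
  set w : NNReal := ‖r‖₊ ^ 2 with hw
  have hvq : (v : ℝ) = ‖q‖ ^ 2 := by simp [hv]
  have hwr : (w : ℝ) = ‖r‖ ^ 2 := by simp [hw]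
  have h1 : ∫⁻ b, ENNReal.ofReal |⟪p, b⟫| * gaussianPDF 0 1 ⟪q, b⟫ ∂stdGaussian F =
      ∫⁻ x, ENNReal.ofReal |c * x.1 + x.2| * gaussianPDF 0 1 x.1
        ∂(gaussianReal 0 v).prod (gaussianReal 0 w) := by
    rw [← map_inner_inner_stdGaussian hqr, lintegral_map (by fun_prop) (by fun_prop)]
    simp [hp, inner_add_left, inner_smul_left]
  have h2 : ∫⁻ x, ENNReal.ofReal |c * x.1 + x.2| * gaussianPDF 0 1 x.1
        ∂(gaussianReal 0 v).prod (gaussianReal 0 w) =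
      gaussianPDF 0 (1 + v) 0 * ∫⁻ x, ENNReal.ofReal |c * x.1 + x.2|
        ∂(gaussianReal 0 (v / (1 + v))).prod (gaussianReal 0 w) := by
    rw [lintegral_prod _ (by fun_prop), lintegral_prod _ (by fun_prop)]
    rw [← smul_eq_mul, ← lintegral_smul_measure, ← gaussianReal_withDensity_gaussianPDF,
      lintegral_withDensity_eq_lintegral_mul _ (by fun_prop) (by fun_prop)]
    refine lintegral_congr fun x => ?_
    simp only [Pi.mul_apply]
    rw [lintegral_mul_const _ (by fun_prop), mul_comm]
  have h3 : ∫⁻ x, ENNReal.ofReal |c * x.1 + x.2|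
        ∂(gaussianReal 0 (v / (1 + v))).prod (gaussianReal 0 w) =
      ENNReal.ofReal (√(2 * (c ^ 2 * (v / (1 + v)) + w) / Real.pi)) := by
    have := lintegral_abs_gaussianReal (NNReal.mk (c ^ 2) (sq_nonneg c) * (v / (1 + v)) + w)
    rw [← map_mul_add_gaussianReal_prod, lintegral_map (by fun_prop) (by fun_prop)] at this
    simpa using this
  rw [h1, h2, h3, gaussianPDF, ← ENNReal.ofReal_mul (gaussianPDFReal_nonneg _ _ _),
    ← ENNReal.ofReal_mul (by positivity)]
  congr 1
  have hpq : ⟪q, p⟫ = c * v := by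
    rw [hp, inner_add_right, inner_smul_right, real_inner_self_eq_norm_sq, hqr, hvq, add_zero]
  have hpp : ‖p‖ ^ 2 = c ^ 2 * v + w := by
    rw [← real_inner_self_eq_norm_sq, hp, hvq, hwr]
    simp only [inner_add_left, inner_add_right, inner_smul_left, inner_smul_right, hqr,
      real_inner_comm q r, real_inner_self_eq_norm_sq]
    simp
    ring
  rw [hpq, hpp, ← hvq]
  have hs : (c ^ 2 * v + w) * (1 + v) - (c * v) ^ 2 =
      (1 + v) * (c ^ 2 * (v / (1 + v)) + w) := by
    field_simp
    ring
  rw [hs]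
  set S : ℝ := c ^ 2 * (v / (1 + v)) + w with hS
  have hS0 : 0 ≤ S := by positivity
  simp only [gaussianPDFReal, sub_zero, NNReal.coe_add, NNReal.coe_one]
  rw [Real.sqrt_mul (by positivity : (0 : ℝ) ≤ 1 + v), mul_div_right_comm 2 S,
    Real.sqrt_mul (by positivity : (0 : ℝ) ≤ 2 / Real.pi)]
  have e1 : (√(2 * Real.pi * (1 + (v : ℝ))))⁻¹ * √(2 / Real.pi) =
      1 / Real.pi * (√(1 + (v : ℝ)))⁻¹ := by
    rw [Real.sqrt_mul (by positivity : (0 : ℝ) ≤ 2 * Real.pi), mul_inv, ← Real.sqrt_inv,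
      mul_right_comm, ← Real.sqrt_mul (by positivity)]
    congr 1
    rw [show (2 * Real.pi)⁻¹ * (2 / Real.pi) = (1 / Real.pi) ^ 2 by field_simp]
    exact Real.sqrt_sq (by positivity)
  have e2 : (√(1 + (v : ℝ)))⁻¹ = √(1 + (v : ℝ)) / (1 + v) := by
    have : 0 < √(1 + (v : ℝ)) := by positivity
    field_simp
    rw [Real.sq_sqrt (by positivity)]
  have e3 : Real.exp (-0 ^ 2 / (2 * (1 + (v : ℝ)))) = 1 := by simp
  rw [e3, mul_one, ← mul_assoc, e1, e2]
  ring

end StdGaussian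

/-! ### Coordinates and linear images of the standard Gaussian measure -/

/-- Insertion of a real number as the `i`-th coordinate of a vector. -/
def insertCoord {n : ℕ} (i : Fin (n + 1)) (p : EuclideanSpace ℝ (Fin n) × ℝ) :
    EuclideanSpace ℝ (Fin (n + 1)) :=
  WithLp.toLp 2 (i.insertNth p.2 p.1)

@[fun_prop]
theorem measurable_insertCoord {n : ℕ} (i : Fin (n + 1)) : Measurable (insertCoord i) := by
  have h : Measurable fun p : EuclideanSpace ℝ (Fin n) × ℝ =>
      (MeasurableEquiv.piFinSuccAbove (fun _ => ℝ) i).symm (p.2, WithLp.ofLp p.1) := by fun_prop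
  exact (WithLp.measurable_toLp 2 _).comp h

theorem map_insertCoord_stdGaussian {n : ℕ} (i : Fin (n + 1)) :
    ((stdGaussian (EuclideanSpace ℝ (Fin n))).prod (gaussianReal 0 1)).map (insertCoord i) =
      stdGaussian (EuclideanSpace ℝ (Fin (n + 1))) := by
  have h := (measurePreserving_piFinSuccAbove (α := fun _ : Fin (n + 1) => ℝ)
    (fun _ => gaussianReal 0 1) i).symm.map_eq
  rw [← map_pi_eq_stdGaussian, ← map_pi_eq_stdGaussian, ← h]
  have h2 := Measure.map_prod_map (Measure.pi fun _ : Fin n => gaussianReal 0 1) (gaussianReal 0 1)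
    (f := WithLp.toLp 2) (g := id) (WithLp.measurable_toLp 2 _) measurable_id
  rw [Measure.map_id] at h2
  rw [h2, Measure.map_map (measurable_insertCoord i) (by fun_prop), ← Measure.prod_swap,
    Measure.map_map (by fun_prop) (by fun_prop), Measure.map_map (by fun_prop) (by fun_prop)]
  rfl

theorem pi_gaussianReal_absolutelyContinuous (n : ℕ) :
    Measure.pi (fun _ : Fin n => gaussianReal 0 1) ≪ Measure.pi (fun _ => volume) := by
  induction n with
  | zero => rw [Measure.pi_of_empty, Measure.pi_of_empty]
  | succ n ih =>
    rw [← (measurePreserving_piFinSuccAbove (α := fun _ : Fin (n + 1) => ℝ)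
        (fun _ => gaussianReal 0 1) 0).symm.map_eq,
      ← (measurePreserving_piFinSuccAbove (α := fun _ : Fin (n + 1) => ℝ)
        (fun _ => volume) 0).symm.map_eq]
    exact ((gaussianReal_absolutelyContinuous 0 one_ne_zero).prod ih).map (by fun_prop)

theorem stdGaussian_absolutelyContinuous (n : ℕ) :
    stdGaussian (EuclideanSpace ℝ (Fin n)) ≪ volume := by
  rw [← map_pi_eq_stdGaussian, ← (PiLp.volume_preserving_toLp (Fin n)).map_eq]
  exact (pi_gaussianReal_absolutelyContinuous n).map (WithLp.measurable_toLp 2 _)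

section Pushforward

variable {E : Type*} [NormedAddCommGroup E] [InnerProductSpace ℝ E] [FiniteDimensional ℝ E]
  [MeasurableSpace E] [BorelSpace E]

/-- If `A` and `B` satisfy `A Aᵀ + B Bᵀ = 1`, the sum of the images under `A` and `B` of
independent standard Gaussian vectors is standard Gaussian. -/
theorem map_add_stdGaussian_prod (A B : E →L[ℝ] E)
    (h : ∀ x, ‖A.adjoint x‖ ^ 2 + ‖B.adjoint x‖ ^ 2 = ‖x‖ ^ 2) :
    ((stdGaussian E).prod (stdGaussian E)).map (fun p => A p.1 + B p.2) = stdGaussian E := by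
  have h2 := Measure.map_prod_map (stdGaussian E) (stdGaussian E) (f := A) (g := B)
    (by fun_prop) (by fun_prop)
  have h3 : ((stdGaussian E).prod (stdGaussian E)).map (fun p => A p.1 + B p.2) =
      (stdGaussian E).map A ∗ (stdGaussian E).map B := by
    rw [Measure.conv, h2, Measure.map_map (by fun_prop) (by fun_prop)]
    rfl
  have hch (L : E →L[ℝ] E) (x : E) :
      charFun ((stdGaussian E).map L) x = Complex.exp (-‖L.adjoint x‖ ^ 2 / 2) := by
    rw [← charFun_stdGaussian, charFun_apply, charFun_apply,
      integral_map (by fun_prop) (by fun_prop)]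
    simp_rw [ContinuousLinearMap.adjoint_inner_right]
  refine Measure.ext_of_charFun ?_
  ext x
  rw [h3, charFun_conv, hch, hch, charFun_stdGaussian, ← Complex.exp_add]
  congr 1
  have := congrArg (fun y : ℝ => (y : ℂ)) (h x)
  push_cast at this
  rw [← this]
  ring

/-- Almost everywhere measurability descends to a singular Gaussian law: if `N ∘ T` is a.e.
measurable for the standard Gaussian measure, then `N` is so for its image under `T`. This is not
formal, since `T` need not be injective: an independent Gaussian vector on the kernel of `T` is
added back, and one of its values is then fixed. -/
theorem aemeasurable_map_stdGaussian (T : E →L[ℝ] E) {N : E → ℝ≥0∞}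
    (h : AEMeasurable (fun x => N (T x)) (stdGaussian E)) :
    AEMeasurable N ((stdGaussian E).map T) := by
  -- `L` will be a pseudo-inverse of `T`: it satisfies `L T = P`, the projection onto `(ker T)ᗮ`.
  let K : Submodule ℝ E := LinearMap.ker (T : E →ₗ[ℝ] E)
  let P : E →L[ℝ] E := Kᗮ.starProjection
  let Q : E →L[ℝ] E := K.starProjection
  have hPQ (x : E) : Q x + P x = x := Submodule.starProjection_add_starProjection_orthogonal x
  have hTQ (x : E) : T (Q x) = 0 := Submodule.starProjection_apply_mem K x
  have hTP (x : E) : T (P x) = T x := by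
    conv_rhs => rw [← hPQ x, map_add, hTQ, zero_add]
  obtain ⟨G, hG⟩ := ((T : E →ₗ[ℝ] E) ∘ₗ Kᗮ.subtype).exists_leftInverse_of_injective (by
    rw [LinearMap.ker_eq_bot']
    intro x hx
    have h1 : (x : E) ∈ K ⊓ Kᗮ := ⟨hx, x.2⟩
    rw [K.inf_orthogonal_eq_bot] at h1
    exact Subtype.ext ((Submodule.mem_bot ℝ).1 h1))
  let L : E →L[ℝ] E := LinearMap.toContinuousLinearMap (Kᗮ.subtype ∘ₗ G)
  have hL (x : E) : L (T x) = P x := by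
    have h1 := LinearMap.congr_fun hG ⟨P x, Submodule.starProjection_apply_mem Kᗮ x⟩
    have h2 : G (T (P x)) = ⟨P x, Submodule.starProjection_apply_mem Kᗮ x⟩ := h1
    rw [← hTP]
    exact congrArg Subtype.val h2
  have hlaw : (((stdGaussian E).map T).prod (stdGaussian E)).map (fun p => L p.1 + Q p.2) =
      stdGaussian E := by
    have h2 := Measure.map_prod_map (stdGaussian E) (stdGaussian E) (f := T) (g := id)
      (by fun_prop) (by fun_prop)
    rw [Measure.map_id] at h2
    rw [h2, Measure.map_map (by fun_prop) (by fun_prop)]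
    have h3 := map_add_stdGaussian_prod P Q fun x => by
      rw [(isSelfAdjoint_starProjection Kᗮ).adjoint_eq, (isSelfAdjoint_starProjection K).adjoint_eq,
        add_comm]
      exact (Submodule.norm_sq_eq_add_norm_sq_starProjection x K).symm
    convert h3 using 2
    ext p
    simp [hL]
  rw [← hlaw] at h
  have hc := h.comp_aemeasurable (f := fun p : E × E => L p.1 + Q p.2) (by fun_prop)
  have hrange : ∀ᵐ p ∂((stdGaussian E).map T).prod (stdGaussian E),
      T (L p.1 + Q p.2) = p.1 := by
    have h1 : ∀ᵐ a ∂(stdGaussian E).map T, T (L a) = a := by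
      rw [ae_map_iff (by fun_prop) (measurableSet_eq_fun (by fun_prop) (by fun_prop))]
      exact ae_of_all _ fun x => by rw [hL, hTP]
    filter_upwards [Measure.quasiMeasurePreserving_fst.ae h1] with p hp
    rw [map_add, hTQ, add_zero, hp]
  have hfst : AEMeasurable (fun p : E × E => N p.1)
      (((stdGaussian E).map T).prod (stdGaussian E)) := by
    refine hc.congr ?_
    filter_upwards [hrange] with p hp
    simp [hp]
  -- For a product measure, measurability of `N ∘ Prod.fst` passes to almost every slice.
  exact (hfst.aestronglyMeasurable.of_comp_fst (NeZero.ne _)).aemeasurable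

end Pushforward

/-! ### Zeros in an affine chart -/

theorem aemeasurable_of_differentiableAt {E : Type*} [NormedAddCommGroup E] [NormedSpace ℝ E]
    [SecondCountableTopology E] [MeasurableSpace E] [BorelSpace E] {f : ℝ → E} {s : Set ℝ}
    (hs : NullMeasurableSet s) (hf : ∀ t ∈ s, DifferentiableAt ℝ f t) :
    AEMeasurable f (volume.restrict s) := by
  obtain ⟨t, hts, htm, hae⟩ := hs.exists_measurable_subset_ae_eq
  rw [← Measure.restrict_congr_set hae]
  exact ContinuousOn.aemeasurable
    (fun x hx => (hf x (hts hx)).continuousAt.continuousWithinAt) htm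

section Chart

variable {n : ℕ} {q : ℝ → EuclideanSpace ℝ (Fin n)} {J : Set ℝ}

/-- The number of `t ∈ J` at which the vector with coordinates `b` and `s` is orthogonal to the
vector with coordinates `q t` and `1`. -/
noncomputable def chartCount (q : ℝ → EuclideanSpace ℝ (Fin n)) (J : Set ℝ)
    (p : EuclideanSpace ℝ (Fin n) × ℝ) : ℝ≥0∞ :=
  fiberCount (fun t => -⟪q t, p.1⟫) J p.2

/-- Joint measurability in all coordinates: the count is the number of preimages under
`(b, t) ↦ (b, -⟪q t, b⟫)`, a map between spaces of equal dimension to which the area formula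
applies. -/
theorem aemeasurable_chartCount (hJ : NullMeasurableSet J)
    (hq : ∀ t ∈ J, DifferentiableAt ℝ q t) :
    AEMeasurable (chartCount q J)
      ((stdGaussian (EuclideanSpace ℝ (Fin n))).prod (gaussianReal 0 1)) := by
  let S : Set (EuclideanSpace ℝ (Fin n) × ℝ) := Prod.snd ⁻¹' J
  let Φ : EuclideanSpace ℝ (Fin n) × ℝ → EuclideanSpace ℝ (Fin n) × ℝ :=
    fun p => (p.1, -⟪q p.2, p.1⟫)
  have hS : NullMeasurableSet S (volume.prod volume) :=
    hJ.preimage Measure.quasiMeasurePreserving_snd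
  have hΦ : ∀ x ∈ S, HasFDerivWithinAt Φ (fderivWithin ℝ Φ S x) S x := by
    intro x hx
    refine DifferentiableWithinAt.hasFDerivWithinAt (DifferentiableAt.differentiableWithinAt ?_)
    have h1 : DifferentiableAt ℝ (fun p : EuclideanSpace ℝ (Fin n) × ℝ => q p.2) x :=
      DifferentiableAt.comp (g := q) x (hq x.2 hx) differentiableAt_snd
    exact differentiableAt_fst.prodMk (h1.inner ℝ differentiableAt_fst).neg
  have h := (areaFormulaOn (μ := volume.prod volume) hS hΦ).1
  have hcount : chartCount q J = fiberCount Φ S := by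
    funext ⟨b, s⟩
    unfold chartCount fiberCount
    rw [← (Prod.mk_right_injective b).encard_image]
    congr 2
    ext ⟨b', t⟩
    simp only [Set.mem_image, Set.mem_inter_iff, Set.mem_preimage, Set.mem_singleton_iff, S, Φ,
      Prod.mk.injEq]
    constructor
    · rintro ⟨t', ⟨h1, h2⟩, rfl, rfl⟩
      exact ⟨h1, rfl, h2⟩
    · rintro ⟨h1, rfl, h2⟩
      exact ⟨t, ⟨h1, h2⟩, rfl, rfl⟩
  rw [hcount]
  exact h.mono_ac ((stdGaussian_absolutelyContinuous n).prod
    (gaussianReal_absolutelyContinuous 0 one_ne_zero))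

/-- The expected number of zeros in one affine chart. The conditional expectation given `b` is the
one-dimensional area formula for `t ↦ -⟪q t, b⟫`, integrated against the Gaussian density. -/
theorem lintegral_chartCount (hJ : NullMeasurableSet J)
    (hq : ∀ t ∈ J, DifferentiableAt ℝ q t) :
    ∫⁻ p, chartCount q J p ∂(stdGaussian (EuclideanSpace ℝ (Fin n))).prod (gaussianReal 0 1) =
      ENNReal.ofReal (1 / Real.pi) * ∫⁻ t in J, ENNReal.ofReal
        (√(‖deriv q t‖ ^ 2 * (1 + ‖q t‖ ^ 2) - ⟪q t, deriv q t⟫ ^ 2) / (1 + ‖q t‖ ^ 2)) := by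
  rw [lintegral_prod _ (aemeasurable_chartCount hJ hq)]
  have hinner (b : EuclideanSpace ℝ (Fin n)) :
      ∫⁻ s, chartCount q J (b, s) ∂gaussianReal 0 1 =
        ∫⁻ t in J, ENNReal.ofReal |⟪deriv q t, b⟫| * gaussianPDF 0 1 ⟪q t, b⟫ := by
    have hder : ∀ t ∈ J, HasDerivAt (fun t => -⟪q t, b⟫) (-⟪deriv q t, b⟫) t := fun t ht => by
      have h := ((hq t ht).hasDerivAt.inner ℝ (hasDerivAt_const t b)).fun_neg
      rwa [inner_zero_right, zero_add] at h
    have harea := areaFormulaOn (μ := volume) hJ fun t ht =>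
      (hder t ht).hasFDerivAt.hasFDerivWithinAt
    have hpdf (x : ℝ) : gaussianPDF 0 1 (-x) = gaussianPDF 0 1 x := by
      simp [gaussianPDF, gaussianPDFReal]
    rw [gaussianReal_of_var_ne_zero _ one_ne_zero,
      lintegral_withDensity_eq_lintegral_mul₀ (f := gaussianPDF 0 1)
        (g := fun s => chartCount q J (b, s)) (by fun_prop) harea.1]
    simp only [Pi.mul_apply, mul_comm (gaussianPDF 0 1 _)]
    refine (harea.2 (gaussianPDF 0 1) (by fun_prop)).trans ?_
    simp [hpdf]
  have hmeas : AEMeasurable (fun p : EuclideanSpace ℝ (Fin n) × ℝ =>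
      ENNReal.ofReal |⟪deriv q p.2, p.1⟫| * gaussianPDF 0 1 ⟪q p.2, p.1⟫)
      ((stdGaussian (EuclideanSpace ℝ (Fin n))).prod (volume.restrict J)) := by
    have h1 : AEMeasurable (fun p : EuclideanSpace ℝ (Fin n) × ℝ => q p.2)
        ((stdGaussian (EuclideanSpace ℝ (Fin n))).prod (volume.restrict J)) :=
      (aemeasurable_of_differentiableAt hJ hq).comp_quasiMeasurePreserving
        Measure.quasiMeasurePreserving_snd
    -- `deriv` of any function is measurable, even though `q` is arbitrary outside `J`.
    have h2 : Measurable (deriv q) := measurable_deriv q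
    have h3 : AEMeasurable (fun p : EuclideanSpace ℝ (Fin n) × ℝ => ⟪q p.2, p.1⟫)
        ((stdGaussian (EuclideanSpace ℝ (Fin n))).prod (volume.restrict J)) :=
      h1.inner measurable_fst.aemeasurable
    have h4 : Measurable (fun p : EuclideanSpace ℝ (Fin n) × ℝ => ⟪deriv q p.2, p.1⟫) :=
      (h2.comp measurable_snd).inner measurable_fst
    exact (ENNReal.measurable_ofReal.comp (measurable_abs.comp h4)).aemeasurable.mul
      ((measurable_gaussianPDF 0 1).comp_aemeasurable h3)
  simp_rw [hinner]
  rw [lintegral_lintegral_swap hmeas]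
  simp_rw [lintegral_abs_inner_mul_gaussianPDF]
  rw [lintegral_const_mul' _ _ ENNReal.ofReal_ne_top]

end Chart

/-! ### The Kac-Rice formula for a standard Gaussian vector -/

section Curve

variable {n : ℕ} {w : ℝ → EuclideanSpace ℝ (Fin (n + 1))} {I : Set ℝ}

/-- The speed of the central projection of the curve `w` to the unit sphere, as the square root of
a Gram determinant over `‖w‖²`. -/
noncomputable def sphericalSpeed {E : Type*} [NormedAddCommGroup E] [InnerProductSpace ℝ E]
    (w : ℝ → E) (t : ℝ) : ℝ :=
  √(‖deriv w t‖ ^ 2 * ‖w t‖ ^ 2 - ⟪w t, deriv w t⟫ ^ 2) / ‖w t‖ ^ 2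

/-- The number of `t ∈ I` such that `w t` is orthogonal to `a`. -/
noncomputable def orthogonalCount {E : Type*} [NormedAddCommGroup E] [InnerProductSpace ℝ E]
    (w : ℝ → E) (I : Set ℝ) (a : E) : ℝ≥0∞ :=
  ({t | t ∈ I ∧ ⟪w t, a⟫ = 0}.encard : ℝ≥0∞)

/-- Separation of the `i`-th coordinate of a vector from the others. -/
def splitCoord (i : Fin (n + 1)) (a : EuclideanSpace ℝ (Fin (n + 1))) :
    EuclideanSpace ℝ (Fin n) × ℝ :=
  (WithLp.toLp 2 (i.removeNth a), a i)

theorem measurePreserving_splitCoord (i : Fin (n + 1)) :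
    MeasurePreserving (splitCoord i) (stdGaussian (EuclideanSpace ℝ (Fin (n + 1))))
      ((stdGaussian (EuclideanSpace ℝ (Fin n))).prod (gaussianReal 0 1)) := by
  have hm : Measurable (splitCoord (n := n) i) := by
    refine Measurable.prodMk ((WithLp.measurable_toLp 2 _).comp (measurable_pi_lambda _ ?_)) ?_
    · intro j
      simp only [Fin.removeNth]
      fun_prop
    · fun_prop
  refine ⟨hm, ?_⟩
  rw [← map_insertCoord_stdGaussian i, Measure.map_map hm (by fun_prop)]
  have : splitCoord i ∘ insertCoord (n := n) i = id := by
    ext p <;> simp [splitCoord, insertCoord]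
  rw [this, Measure.map_id]

theorem inner_eq_splitCoord (i : Fin (n + 1)) (x y : EuclideanSpace ℝ (Fin (n + 1))) :
    ⟪x, y⟫ = x i * y i + ⟪(splitCoord i x).1, (splitCoord i y).1⟫ := by
  simp [PiLp.inner_apply, splitCoord, Fin.sum_univ_succAbove _ i, Fin.removeNth, mul_comm]

/-- The Kac-Rice formula for the zeros of `t ↦ ⟪w t, a⟫` in `I`, where `a` is standard Gaussian. -/
def KacRiceOn (w : ℝ → EuclideanSpace ℝ (Fin (n + 1))) (I : Set ℝ) : Prop :=
  AEMeasurable (orthogonalCount w I) (stdGaussian (EuclideanSpace ℝ (Fin (n + 1)))) ∧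
    ∫⁻ a, orthogonalCount w I a ∂stdGaussian (EuclideanSpace ℝ (Fin (n + 1))) =
      ENNReal.ofReal (1 / Real.pi) * ∫⁻ t in I, ENNReal.ofReal (sphericalSpeed w t)

/-- The Kac-Rice formula on a set where the `i`-th coordinate of `w` does not vanish: dividing by
that coordinate changes neither the zeros nor the projection to the sphere. -/
theorem kacRiceOn_of_coord_ne_zero (hI : NullMeasurableSet I)
    (hw : ∀ t ∈ I, DifferentiableAt ℝ w t) (i : Fin (n + 1)) (hi : ∀ t ∈ I, w t i ≠ 0) :
    KacRiceOn w I := by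
  let R : EuclideanSpace ℝ (Fin (n + 1)) →L[ℝ] EuclideanSpace ℝ (Fin n) :=
    LinearMap.toContinuousLinearMap
      { toFun := fun a => (splitCoord i a).1
        map_add' := fun _ _ => rfl
        map_smul' := fun _ _ => rfl }
  let q : ℝ → EuclideanSpace ℝ (Fin n) := fun t => (w t i)⁻¹ • R (w t)
  have hq : ∀ t ∈ I, HasDerivAt q
      ((w t i)⁻¹ • R (deriv w t) + (-(deriv w t i) / (w t i) ^ 2) • R (w t)) t := by
    intro t ht
    have h1 : HasDerivAt (fun t => w t i) (deriv w t i) t :=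
      (EuclideanSpace.proj (𝕜 := ℝ) i).hasFDerivAt.comp_hasDerivAt t (hw t ht).hasDerivAt
    exact (h1.inv (hi t ht)).smul (R.hasFDerivAt.comp_hasDerivAt t (hw t ht).hasDerivAt)
  have hcount : orthogonalCount w I = chartCount q I ∘ splitCoord i := by
    funext a
    unfold orthogonalCount chartCount fiberCount
    congr 2
    ext t
    simp only [Set.mem_ofPred_eq, Set.mem_inter_iff, Set.mem_preimage, Set.mem_singleton_iff]
    refine and_congr_right fun ht => ?_
    have hne := hi t ht
    have e1 : ⟪q t, (splitCoord i a).1⟫ =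
        (w t i)⁻¹ * ⟪(splitCoord i (w t)).1, (splitCoord i a).1⟫ := by
      simp only [q, real_inner_smul_left]
      rfl
    have e2 : (splitCoord i a).2 = a i := rfl
    rw [inner_eq_splitCoord i, e1, e2]
    constructor
    · intro h
      field_simp
      linarith
    · intro h
      rw [← h]
      field_simp
      ring
  have hspeed : ∀ t ∈ I, √(‖deriv q t‖ ^ 2 * (1 + ‖q t‖ ^ 2) - ⟪q t, deriv q t⟫ ^ 2) /
      (1 + ‖q t‖ ^ 2) = sphericalSpeed w t := by
    intro t ht
    have hne := hi t ht
    have e (x y : EuclideanSpace ℝ (Fin (n + 1))) : ⟪x, y⟫ = x i * y i + ⟪R x, R y⟫ :=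
      inner_eq_splitCoord i x y
    unfold sphericalSpeed
    rw [(hq t ht).deriv]
    simp only [← real_inner_self_eq_norm_sq, q, e (w t), e (deriv w t), inner_add_left,
      inner_add_right, real_inner_smul_left, real_inner_smul_right,
      real_inner_comm (R (w t)) (R (deriv w t))]
    have hU : 0 ≤ ⟪R (w t), R (w t)⟫ := real_inner_self_nonneg
    generalize ⟪R (w t), R (w t)⟫ = U at *
    generalize ⟪R (deriv w t), R (deriv w t)⟫ = V
    generalize ⟪R (w t), R (deriv w t)⟫ = W
    generalize w t i = x at *
    generalize deriv w t i = y
    have hx4 : √(x ^ 4) = x ^ 2 := by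
      rw [show x ^ 4 = (x ^ 2) ^ 2 by ring, Real.sqrt_sq (by positivity)]
    have e1 : 1 + x⁻¹ * (x⁻¹ * U) = (x * x + U) / x ^ 2 := by
      field_simp
    rw [e1]
    trans √(((y * y + V) * (x * x + U) - (x * y + W) ^ 2) / x ^ 4) / ((x * x + U) / x ^ 2)
    · congr 2
      field_simp
      ring
    · have hpos : 0 < x * x + U := by
        have := mul_self_pos.2 hne
        positivity
      rw [Real.sqrt_div' _ (by positivity), hx4]
      field_simp
  have hqd : ∀ t ∈ I, DifferentiableAt ℝ q t := fun t ht => (hq t ht).differentiableAt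
  have hmp := measurePreserving_splitCoord (n := n) i
  refine ⟨?_, ?_⟩
  · rw [hcount]
    exact (aemeasurable_chartCount hI hqd).comp_quasiMeasurePreserving hmp.quasiMeasurePreserving
  · have h1 := lintegral_chartCount hI hqd
    have hm := aemeasurable_chartCount hI hqd
    rw [← hmp.map_eq] at h1 hm
    rw [lintegral_map' hm hmp.measurable.aemeasurable] at h1
    simp only [hcount, Function.comp_apply]
    rw [h1]
    congr 1
    have hae : ∀ᵐ t ∂volume.restrict I, t ∈ I := ae_restrict_mem₀ hI
    exact lintegral_congr_ae (by filter_upwards [hae] with t ht; rw [hspeed t ht])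

theorem KacRiceOn.iUnion {ι : Type*} [Countable ι] {I : ι → Set ℝ}
    (hd : Pairwise (Function.onFun Disjoint I)) (hm : ∀ i, NullMeasurableSet (I i))
    (h : ∀ i, KacRiceOn w (I i)) : KacRiceOn w (⋃ i, I i) := by
  have hcount : orthogonalCount w (⋃ i, I i) = fun a => ∑' i, orthogonalCount w (I i) a := by
    funext a
    have h1 := Set.encard_iUnion_eq_tsum (s := fun i => {t | t ∈ I i ∧ ⟪w t, a⟫ = 0})
      fun i j hij => (hd hij).mono (fun _ h => h.1) fun _ h => h.1
    unfold orthogonalCount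
    rw [← h1]
    congr 2
    ext t
    simp
  refine ⟨?_, ?_⟩
  · rw [hcount]
    exact AEMeasurable.tsum fun i => (h i).1
  · rw [hcount, lintegral_tsum fun i => (h i).1, lintegral_iUnion₀ hm fun i j hij =>
      (hd hij).aedisjoint, ← ENNReal.tsum_mul_left]
    exact tsum_congr fun i => (h i).2

/-- **Kac-Rice formula** for a standard Gaussian vector: the line is cut into the finitely many
sets on which a given coordinate of `w` is the first one that does not vanish. -/
theorem kacRiceOn (hI : NullMeasurableSet I) (hw : ∀ t ∈ I, DifferentiableAt ℝ w t)
    (hw0 : ∀ t ∈ I, w t ≠ 0) : KacRiceOn w I := by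
  let S : Fin (n + 1) → Set ℝ := fun i => {t ∈ I | w t i ≠ 0}
  let J : Fin (n + 1) → Set ℝ := fun i => S i \ ⋃ j : Set.Iio i, S j
  have hS (i : Fin (n + 1)) : NullMeasurableSet (S i) := by
    have h1 : NullMeasurableSet {t | w t i ≠ 0} (volume.restrict I) :=
      ((EuclideanSpace.proj (𝕜 := ℝ) i).continuous.measurable.comp_aemeasurable
        (aemeasurable_of_differentiableAt hI hw)).nullMeasurableSet_preimage
        (measurableSet_singleton (0 : ℝ)).compl
    rw [nullMeasurableSet_restrict hI] at h1
    rwa [Set.inter_comm] at h1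
  have hJ (i : Fin (n + 1)) : NullMeasurableSet (J i) :=
    (hS i).diff (NullMeasurableSet.iUnion fun j => hS j)
  have hlt {i j : Fin (n + 1)} (hij : i < j) : Disjoint (J i) (J j) := by
    rw [Set.disjoint_left]
    exact fun t hi hj => hj.2 (Set.mem_iUnion.2 ⟨⟨i, hij⟩, hi.1⟩)
  have hd : Pairwise (Function.onFun Disjoint J) := fun i j hij =>
    hij.lt_or_gt.elim hlt fun h => (hlt h).symm
  have hU : I = ⋃ i, J i := by
    refine Set.Subset.antisymm (fun t ht => ?_) (Set.iUnion_subset fun i t h => h.1.1)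
    have hne : {i | w t i ≠ 0}.Nonempty := by
      by_contra h
      rw [Set.not_nonempty_iff_eq_empty, Set.eq_empty_iff_forall_notMem] at h
      exact hw0 t ht (PiLp.ext fun i => not_not.1 (h i))
    obtain ⟨i, hi, hmin⟩ := WellFounded.has_min (wellFounded_lt (α := Fin (n + 1))) _ hne
    refine Set.mem_iUnion.2 ⟨i, ⟨ht, hi⟩, fun hmem => ?_⟩
    obtain ⟨j, hj⟩ := Set.mem_iUnion.1 hmem
    exact hmin j hj.2 j.2
  rw [hU]
  exact KacRiceOn.iUnion hd hJ fun i => kacRiceOn_of_coord_ne_zero (hJ i)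
    (fun t ht => hw t ht.1.1) i fun t ht => ht.1.2

end Curve

/-! ### Spherical speed and the logarithmic kernel -/

section Curve

variable {E : Type*} [NormedAddCommGroup E] [InnerProductSpace ℝ E] {w : ℝ → E} {w' : E} {t : ℝ}

theorem hasDerivAt_normalize (hw : HasDerivAt w w' t) (h0 : w t ≠ 0) :
    HasDerivAt (fun s => ‖w s‖⁻¹ • w s)
      (‖w t‖⁻¹ • w' - (⟪w t, w'⟫ / ‖w t‖ ^ 3) • w t) t := by
  have hpos : 0 < ‖w t‖ := norm_pos_iff.2 h0
  have h1 : HasDerivAt (fun s => ‖w s‖) (⟪w t, w'⟫ / ‖w t‖) t := by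
    have h := hw.norm_sq.sqrt (by positivity)
    simp only [Real.sqrt_sq (norm_nonneg _)] at h
    convert h using 1
    field_simp
  have h2 := (h1.inv hpos.ne').smul hw
  refine h2.congr_deriv ?_
  rw [sub_eq_add_neg, ← neg_smul]
  congr 2
  field_simp

theorem norm_deriv_normalize (hw : DifferentiableAt ℝ w t) (h0 : w t ≠ 0) :
    ‖deriv (fun s => ‖w s‖⁻¹ • w s) t‖ = sphericalSpeed w t := by
  have hpos : 0 < ‖w t‖ := norm_pos_iff.2 h0
  rw [(hasDerivAt_normalize hw.hasDerivAt h0).deriv, ← Real.sqrt_sq (norm_nonneg (_ - _)),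
    sphericalSpeed]
  trans √((‖deriv w t‖ ^ 2 * ‖w t‖ ^ 2 - ⟪w t, deriv w t⟫ ^ 2) / (‖w t‖ ^ 2) ^ 2)
  · congr 1
    rw [norm_sub_sq_real, norm_smul, norm_smul, real_inner_smul_left, real_inner_smul_right,
      real_inner_comm, mul_pow, mul_pow, Real.norm_eq_abs, Real.norm_eq_abs, sq_abs, sq_abs]
    field_simp
    ring
  · rw [Real.sqrt_div' _ (by positivity), Real.sqrt_sq (by positivity)]

theorem sphericalSpeed_nonneg : 0 ≤ sphericalSpeed w t := by
  unfold sphericalSpeed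
  positivity

theorem sq_sphericalSpeed (h0 : w t ≠ 0) : sphericalSpeed w t ^ 2 =
    ‖deriv w t‖ ^ 2 / ‖w t‖ ^ 2 - ⟪w t, deriv w t⟫ ^ 2 / (‖w t‖ ^ 2) ^ 2 := by
  have hpos : 0 < ‖w t‖ := norm_pos_iff.2 h0
  have hcs : ⟪w t, deriv w t⟫ ^ 2 ≤ ‖deriv w t‖ ^ 2 * ‖w t‖ ^ 2 := by
    rw [← mul_pow, ← sq_abs, mul_comm]
    gcongr
    exact abs_real_inner_le_norm _ _
  rw [sphericalSpeed, div_pow, Real.sq_sqrt (sub_nonneg.2 hcs)]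
  field_simp

theorem eventually_inner_pos (hw : ContinuousAt w t) (h0 : w t ≠ 0) :
    ∀ᶠ p : ℝ × ℝ in 𝓝 (t, t), 0 < ⟪w p.1, w p.2⟫ := by
  have h1 : ContinuousAt (fun p : ℝ × ℝ => ⟪w p.1, w p.2⟫) (t, t) :=
    (ContinuousAt.comp (g := w) hw continuousAt_fst).inner
      (ContinuousAt.comp (g := w) hw continuousAt_snd)
  exact h1.eventually (lt_mem_nhds (real_inner_self_pos.2 h0))

theorem hasMixedPartialAt_log_inner (hw : DifferentiableAt ℝ w t) (h0 : w t ≠ 0) :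
    HasMixedPartialAt (fun x y => Real.log ⟪w x, w y⟫) t t ∧
      mixedPartial (fun x y => Real.log ⟪w x, w y⟫) t t = sphericalSpeed w t ^ 2 := by
  have hpos : 0 < ⟪w t, w t⟫ := real_inner_self_pos.2 h0
  have hev : ∀ᶠ x in 𝓝 t, 0 < ⟪w x, w t⟫ :=
    (hw.continuousAt.inner continuousAt_const).eventually (lt_mem_nhds hpos)
  have hsnd (x : ℝ) (hx : 0 < ⟪w x, w t⟫) :
      HasDerivAt (fun y => Real.log ⟪w x, w y⟫) (⟪w x, deriv w t⟫ / ⟪w x, w t⟫) t := by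
    have h := ((hasDerivAt_const t (w x)).inner ℝ hw.hasDerivAt).log hx.ne'
    rwa [inner_zero_left, add_zero] at h
  have heq : (fun x => partialSnd (fun x y => Real.log ⟪w x, w y⟫) x t) =ᶠ[𝓝 t]
      fun x => ⟪w x, deriv w t⟫ / ⟪w x, w t⟫ := by
    filter_upwards [hev] with x hx using (hsnd x hx).deriv
  have hder := (hw.hasDerivAt.inner ℝ (hasDerivAt_const t (deriv w t))).div
    (hw.hasDerivAt.inner ℝ (hasDerivAt_const t (w t))) hpos.ne'
  refine ⟨⟨?_, hder.differentiableAt.congr_of_eventuallyEq heq⟩, ?_⟩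
  · filter_upwards [hev] with x hx using (hsnd x hx).differentiableAt
  · unfold mixedPartial
    rw [heq.deriv_eq, sq_sphericalSpeed h0]
    refine hder.deriv.trans ?_
    rw [real_inner_self_eq_norm_sq] at hpos
    rw [inner_zero_right, zero_add, zero_add, real_inner_self_eq_norm_sq,
      real_inner_self_eq_norm_sq, real_inner_comm (w t) (deriv w t)]
    field_simp

end Curve

/-! ### Gaussian vectors with covariance matrix `C` -/

section RootCurve

variable {n : ℕ} {f : Fin (n + 1) → ℝ → ℝ} {C : Matrix (Fin (n + 1)) (Fin (n + 1)) ℝ}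

theorem adjoint_toEuclideanCLM_sqrt :
    (Matrix.toEuclideanCLM (𝕜 := ℝ) (CFC.sqrt C)).adjoint =
      Matrix.toEuclideanCLM (𝕜 := ℝ) (CFC.sqrt C) :=
  ((CFC.sqrt_nonneg C).isSelfAdjoint.map _ : IsSelfAdjoint
    (Matrix.toEuclideanCLM (𝕜 := ℝ) (CFC.sqrt C))).adjoint_eq

theorem differentiableAt_rootCurve {t : ℝ} (hf : ∀ i, DifferentiableAt ℝ (f i) t) :
    DifferentiableAt ℝ (rootCurve C f) t := by
  have h : DifferentiableAt ℝ (basisCurve f) t := differentiableAt_euclidean.2 hf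
  exact (Matrix.toEuclideanCLM (𝕜 := ℝ) (CFC.sqrt C)).differentiableAt.comp t h

theorem covKernel_eq_inner (hC : C.PosSemidef) (x y : ℝ) :
    covKernel C f x y = ⟪rootCurve C f x, rootCurve C f y⟫ := by
  unfold rootCurve
  rw [← ContinuousLinearMap.adjoint_inner_right, adjoint_toEuclideanCLM_sqrt,
    ← ContinuousLinearMap.comp_apply, ← ContinuousLinearMap.mul_def, ← map_mul,
    CFC.sqrt_mul_sqrt_self _ hC.nonneg,
    Matrix.inner_toEuclideanCLM]
  rfl

theorem zeroCount_toEuclideanCLM_sqrt (I : Set ℝ) (x : EuclideanSpace ℝ (Fin (n + 1))) :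
    zeroCount f I (Matrix.toEuclideanCLM (𝕜 := ℝ) (CFC.sqrt C) x) =
      orthogonalCount (rootCurve C f) I x := by
  unfold zeroCount orthogonalCount rootCurve
  simp_rw [← ContinuousLinearMap.adjoint_inner_right _ _ x, adjoint_toEuclideanCLM_sqrt]
  simp [PiLp.inner_apply, basisCurve]

end RootCurve

theorem theorem3p1 {Ω : Type*} [MeasurableSpace Ω] (P : Measure Ω) (n : ℕ)
    (f : Fin (n + 1) → ℝ → ℝ) (C : Matrix (Fin (n + 1)) (Fin (n + 1)) ℝ) (hC : C.PosSemidef)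
    (a : Ω → EuclideanSpace ℝ (Fin (n + 1)))
    (ha : HasLaw a (multivariateGaussian 0 C) P)
    (I : Set ℝ) (hI : NullMeasurableSet I volume)
    (hf : ∀ i, ∀ t ∈ I, DifferentiableAt ℝ (f i) t)
    (hw : ∀ t ∈ I, rootCurve C f t ≠ 0) :
    (∀ t ∈ I, DifferentiableAt ℝ (unitCurve C f) t) ∧
    (∀ t ∈ I, (∀ᶠ p : ℝ × ℝ in 𝓝 (t, t), 0 < covKernel C f p.1 p.2) ∧
      HasMixedPartialAt (fun x y => Real.log (covKernel C f x y)) t t ∧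
      0 ≤ mixedPartial (fun x y => Real.log (covKernel C f x y)) t t) ∧
    AEMeasurable (fun ω => zeroCount f I (a ω)) P ∧
    (∫⁻ ω, zeroCount f I (a ω) ∂P) =
      ENNReal.ofReal (1 / Real.pi) * ∫⁻ t in I, ENNReal.ofReal ‖deriv (unitCurve C f) t‖ ∧
    (∫⁻ ω, zeroCount f I (a ω) ∂P) =
      ENNReal.ofReal (1 / Real.pi) * ∫⁻ t in I, ENNReal.ofReal
        (Real.sqrt (mixedPartial (fun x y => Real.log (covKernel C f x y)) t t)) := by
  set w := rootCurve C f with hw_def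
  have hwd : ∀ t ∈ I, DifferentiableAt ℝ w t := fun t ht =>
    differentiableAt_rootCurve fun i => hf i t ht
  have hlog : (fun x y => Real.log (covKernel C f x y)) = fun x y => Real.log ⟪w x, w y⟫ := by
    funext x y
    rw [covKernel_eq_inner hC]
  set T := Matrix.toEuclideanCLM (𝕜 := ℝ) (CFC.sqrt C) with hT
  have hlaw : multivariateGaussian 0 C =
      (stdGaussian (EuclideanSpace ℝ (Fin (n + 1)))).map T := by
    simp [multivariateGaussian, hT]
  obtain ⟨hkm, hki⟩ := kacRiceOn hI hwd hw
  have hzero (x : EuclideanSpace ℝ (Fin (n + 1))) :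
      zeroCount f I (T x) = orthogonalCount w I x := zeroCount_toEuclideanCLM_sqrt I x
  have hmeas : AEMeasurable (zeroCount f I) (multivariateGaussian 0 C) := by
    rw [hlaw]
    refine aemeasurable_map_stdGaussian T ?_
    simpa only [hzero] using hkm
  have hmean : ∫⁻ ω, zeroCount f I (a ω) ∂P =
      ENNReal.ofReal (1 / Real.pi) * ∫⁻ t in I, ENNReal.ofReal (sphericalSpeed w t) := by
    rw [← hki, ← lintegral_map' (f := zeroCount f I) (by rwa [ha.map_eq]) ha.aemeasurable,
      ha.map_eq, hlaw, lintegral_map' (by rwa [← hlaw]) (by fun_prop)]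
    simp only [hzero]
  have hmem : ∀ᵐ t ∂volume.restrict I, t ∈ I := ae_restrict_mem₀ hI
  refine ⟨fun t ht => (hasDerivAt_normalize (hwd t ht).hasDerivAt (hw t ht)).differentiableAt,
    fun t ht => ⟨?_, ?_, ?_⟩, ?_, ?_, ?_⟩
  · simpa only [covKernel_eq_inner hC] using eventually_inner_pos (hwd t ht).continuousAt (hw t ht)
  · rw [hlog]
    exact (hasMixedPartialAt_log_inner (hwd t ht) (hw t ht)).1
  · rw [hlog, (hasMixedPartialAt_log_inner (hwd t ht) (hw t ht)).2]
    positivity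
  · exact AEMeasurable.comp_aemeasurable (g := zeroCount f I) (by rwa [ha.map_eq]) ha.aemeasurable
  · rw [hmean]
    congr 1
    refine lintegral_congr_ae ?_
    filter_upwards [hmem] with t ht
    rw [← norm_deriv_normalize (hwd t ht) (hw t ht)]
    rfl
  · rw [hmean]
    congr 1
    refine lintegral_congr_ae ?_
    filter_upwards [hmem] with t ht
    rw [hlog, (hasMixedPartialAt_log_inner (hwd t ht) (hw t ht)).2,
      Real.sqrt_sq sphericalSpeed_nonneg]
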